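/- Let $A\to M$ be a smooth real vector bundle of finite rank over a smooth (finite-dimensional, Hausdorff, second countable, boundaryless) manifold, with a Lie algebroid structure: a Lie bracket $[\cdot,\cdot]$ on $\Gamma(A)$ and an anchor $\rho:A\to TM$ with $[X,fY]=f[X,Y]+(\rho(X)f)\,Y$. Let $\mathrm{d}$ be the differential of the Lie algebroid on $\Gamma(\wedge^\bullet A^*)$, and denote also by $[\cdot,\cdot]$ the Schouten–Nijenhuis bracket on $\Gamma(\wedge^\bullet A)$. For a bivector $\pi$ and a 2-form $\omega$ put $\langle\beta,\pi^\sharp\alpha\rangle=\pi(\alpha,\beta)$ and $\langle\omega^\flat X,Y\rangle=\omega(X,Y)$; a bivector $\pi$ is the inverse of a non-degenerate 2-form $\omega$ if $\pi^\sharp=(\omega^\flat)^{-1}$. Indices are taken in $\mathbb Z/3\mathbb Z=\{1,2,3\}$. Let $\omega_1,\omega_2,\omega_3\in\Gamma(\wedge^2A^*)$ be non-degenerate with inverses $\pi_1,\pi_2,\pi_3$, and let $N_i:=\pi_{i-1}^\sharp\circ\omega_{i+1}^\flat:A\to A$. For signs $\varepsilon_1,\varepsilon_2,\varepsilon_3\in\{1,-1\}$,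 the triplet $(\omega_1,\omega_2,\omega_3)$ is an $\varepsilon$-hypersymplectic structure with torsion if $$N_i^2=\varepsilon_i\,\mathrm{id}_A\quad(i=1,2,3),\qquad \varepsilon_2\,N_1\mathrm{d}\omega_1=\varepsilon_3\,N_2\mathrm{d}\omega_2=\varepsilon_1\,N_3\mathrm{d}\omega_3,$$ where $N_i\mathrm{d}\omega_i(X,Y,Z):=\mathrm{d}\omega_i(N_iX,N_iY,N_iZ)$. It is a hypersymplectic structure with torsion if $\varepsilon_1=\varepsilon_2=\varepsilon_3=-1$, and a para-hypersymplectic structure with torsion if $\varepsilon_1\varepsilon_2\varepsilon_3=-1$ and the $\varepsilon_i$ are not all equal to $-1$. **Proposition.** Let $(\omega_1,\omega_2,\omega_3)$ be a hypersymplectic or para-hypersymplectic structure with torsion on the Lie algebroid $A$, and let $\pi_k$ be the inverse of $\omega_k$, $k=1,2,3$. Then $[\pi_i,\pi_j]=0$ for all $i,j\in\{1,2,3\}$ with $i\neq j$. -/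

import Mathlib

open scoped Manifold ContDiff
open Bundle

noncomputable section

namespace HSTorsion

section Bundles

variable {E : Type*} [NormedAddCommGroup E] [NormedSpace ℝ E]
  {H : Type*} [TopologicalSpace H] (I : ModelWithCorners ℝ E H)
  {M : Type*} [TopologicalSpace M] [ChartedSpace H M] [IsManifold I ∞ M]
  (F : Type*) [NormedAddCommGroup F] [NormedSpace ℝ F]
  (V : M → Type*) [TopologicalSpace (TotalSpace F V)]
  [∀ x, AddCommGroup (V x)] [∀ x, Module ℝ (V x)] [∀ x, TopologicalSpace (V x)]
  [∀ x, IsTopologicalAddGroup (V x)] [∀ x, ContinuousSMul ℝ (V x)]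
  [FiberBundle F V] [VectorBundle ℝ F V]

/-- The smooth sections `Γ(A)` of the vector bundle `A → M` with fibres `V x`. -/
abbrev Sec := Cₛ^∞⟮I; F, V⟯

/-- The smooth sections `Γ(A*)` of the dual bundle. -/
abbrev DualSec := Cₛ^∞⟮I; F →L[ℝ] ℝ, fun x => V x →L[ℝ] ℝ⟯

variable {I F V}

/-- The product `f X` of a smooth function and a smooth section. -/
def smulSec (f : C^∞⟮I, M; 𝓘(ℝ, ℝ), ℝ⟯) (X : Sec I F V) : Sec I F V where
  toFun := fun x => f x • X x
  contMDiff_toFun := ContMDiff.smul_section f.contMDiff X.contMDiff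

/-- The derivative `df(ξ)` of a function `f : M → ℝ` along a tangent vector `ξ` at `x`. -/
def dirDeriv (f : M → ℝ) (x : M) (ξ : TangentSpace I x) : ℝ :=
  mfderiv I 𝓘(ℝ, ℝ) f x ξ

variable (I F V)

/-- A Lie algebroid structure on the vector bundle `A → M`: a real Lie bracket on `Γ(A)` and an
anchor `ρ : A → TM` (a smooth vector bundle morphism over the identity) with the Leibniz rule
`[X, fY] = f[X, Y] + (ρ(X) f) Y`. -/
structure LieAlgebroid where
  bracket : Sec I F V →ₗ[ℝ] Sec I F V →ₗ[ℝ] Sec I F V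
  bracket_self : ∀ X, bracket X X = 0
  jacobi : ∀ X Y Z,
    bracket X (bracket Y Z) + bracket Y (bracket Z X) + bracket Z (bracket X Y) = 0
  anchor : Cₛ^∞⟮I; F →L[ℝ] E, fun x => V x →L[ℝ] TangentSpace I x⟯
  leibniz : ∀ (X : Sec I F V) (f : C^∞⟮I, M; 𝓘(ℝ, ℝ), ℝ⟯) (Y : Sec I F V) (x : M),
    bracket X (smulSec f Y) x = f x • bracket X Y x + dirDeriv f x (anchor x (X x)) • Y x

/-- A 2-form `w ∈ Γ(⋀² A*)`: a smooth family of alternating bilinear forms on the fibres,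
curried, so that `flat x` is `w♭` at `x`, with `⟨w♭ X, Y⟩ = w(X, Y)`. -/
structure TwoForm where
  flat : Cₛ^∞⟮I; F →L[ℝ] F →L[ℝ] ℝ, fun x => V x →L[ℝ] V x →L[ℝ] ℝ⟯
  alt : ∀ (x : M) (v : V x), flat x v v = 0

/-- A bivector `P ∈ Γ(⋀² A)`: a smooth family of alternating bilinear forms
`P(α, β) = ⟨β, P♯ α⟩` on the duals of the (finite-dimensional) fibres, recorded by the
bundle map `P♯ : A* → A`. -/
structure Bivector where
  sharp : Cₛ^∞⟮I; (F →L[ℝ] ℝ) →L[ℝ] F, fun x => (V x →L[ℝ] ℝ) →L[ℝ] V x⟯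
  alt : ∀ (x : M) (a : V x →L[ℝ] ℝ), a (sharp x a) = 0

variable {I F V}

/-- The function `w(X, Y)` for sections `X, Y` of `A`. -/
def TwoForm.eval (w : TwoForm I F V) (X Y : Sec I F V) : M → ℝ :=
  fun x => w.flat x (X x) (Y x)

/-- The section `w♭ X` of `A*`. -/
def TwoForm.flatSec (w : TwoForm I F V) (X : Sec I F V) : DualSec I F V where
  toFun := fun x => w.flat x (X x)
  contMDiff_toFun := ContMDiff.clm_bundle_apply w.flat.contMDiff X.contMDiff

/-- The section `P♯ α` of `A`. -/
def Bivector.sharpSec (P : Bivector I F V) (α : DualSec I F V) : Sec I F V where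
  toFun := fun x => P.sharp x (α x)
  contMDiff_toFun := ContMDiff.clm_bundle_apply P.sharp.contMDiff α.contMDiff

/-- `P` is the inverse of `w`: the bundle maps `P♯` and `w♭` are inverse to each other. In
particular `w` is non-degenerate; conversely a non-degenerate 2-form has exactly one inverse. -/
def IsInverse (w : TwoForm I F V) (P : Bivector I F V) : Prop :=
  (∀ (x : M) (v : V x), P.sharp x (w.flat x v) = v) ∧
    ∀ (x : M) (a : V x →L[ℝ] ℝ), w.flat x (P.sharp x a) = a

namespace LieAlgebroid

variable (L : LieAlgebroid I F V)

/-- The function `ρ(X) f`. -/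
def deriv (X : Sec I F V) (f : M → ℝ) : M → ℝ :=
  fun x => dirDeriv f x (L.anchor x (X x))

/-- The Lie algebroid differential of a 2-form, evaluated on three sections of `A`. -/
def d (w : TwoForm I F V) (X Y Z : Sec I F V) : M → ℝ :=
  L.deriv X (w.eval Y Z) - L.deriv Y (w.eval X Z) + L.deriv Z (w.eval X Y)
    - w.eval (L.bracket X Y) Z + w.eval (L.bracket X Z) Y - w.eval (L.bracket Y Z) X

/-- The Lie derivative of a section of `A*`, as the function
`⟨ℒ_X β, Y⟩ = ρ(X)⟨β, Y⟩ - ⟨β, [X, Y]⟩`. -/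
def lieDeriv (X : Sec I F V) (β : DualSec I F V) (Y : Sec I F V) : M → ℝ :=
  L.deriv X (fun x => β x (Y x)) - fun x => β x (L.bracket X Y x)

/-- The cyclic summand `⟨ℒ_{P♯α} β, Q♯γ⟩ + ⟨ℒ_{Q♯α} β, P♯γ⟩` of the Schouten bracket. -/
def schoutenTerm (P Q : Bivector I F V) (α β γ : DualSec I F V) : M → ℝ :=
  L.lieDeriv (P.sharpSec α) β (Q.sharpSec γ) + L.lieDeriv (Q.sharpSec α) β (P.sharpSec γ)

/-- The Schouten-Nijenhuis bracket `[P, Q] ∈ Γ(⋀³ A)` of two bivectors, evaluated on three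
sections of `A*`: `[P, Q](α, β, γ)` is the cyclic sum over `(α, β, γ)` of
`⟨ℒ_{P♯α} β, Q♯γ⟩ + ⟨ℒ_{Q♯α} β, P♯γ⟩`.

This is the bracket which on decomposable bivectors reads
`[X ∧ Y, Z ∧ W] = [X, Z] ∧ Y ∧ W - [X, W] ∧ Y ∧ Z - [Y, Z] ∧ X ∧ W + [Y, W] ∧ X ∧ Z`,
where `(X ∧ Y)(α, β) = α(X) β(Y) - α(Y) β(X)` and `X ∧ Y ∧ Z` is likewise a determinant. -/
def schouten (P Q : Bivector I F V) (α β γ : DualSec I F V) : M → ℝ :=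
  L.schoutenTerm P Q α β γ + L.schoutenTerm P Q β γ α + L.schoutenTerm P Q γ α β

end LieAlgebroid

/-- The transition morphisms `N i = P (i-1)♯ ∘ w (i+1)♭`, with indices modulo 3, on the fibres. -/
def transition (w : ZMod 3 → TwoForm I F V) (P : ZMod 3 → Bivector I F V) (i : ZMod 3) (x : M) :
    V x →L[ℝ] V x :=
  ((P (i - 1)).sharp x).comp ((w (i + 1)).flat x)

/-- The action of the transition morphism `N i` on sections of `A`. -/
def transitionSec (w : ZMod 3 → TwoForm I F V) (P : ZMod 3 → Bivector I F V) (i : ZMod 3)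
    (X : Sec I F V) : Sec I F V :=
  (P (i - 1)).sharpSec ((w (i + 1)).flatSec X)

theorem transitionSec_apply (w : ZMod 3 → TwoForm I F V) (P : ZMod 3 → Bivector I F V)
    (i : ZMod 3) (X : Sec I F V) (x : M) :
    transitionSec w P i X x = transition w P i x (X x) := rfl

/-- `w = (w 1, w 2, w 3)` is an `ε`-hypersymplectic structure with torsion on the Lie algebroid
`L`: the `w i` are non-degenerate, with inverses `P i`; the signs are `ε i = ±1`; the transition
morphisms satisfy `N i ∘ N i = ε i • id`; and
`ε 2 • N 1 dw 1 = ε 3 • N 2 dw 2 = ε 1 • N 3 dw 3`,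
where `(N i dw i)(X, Y, Z) = dw i (N i X, N i Y, N i Z)`. -/
def IsEpsHypersymplecticWithTorsion (L : LieAlgebroid I F V) (ε : ZMod 3 → ℝ)
    (w : ZMod 3 → TwoForm I F V) : Prop :=
  (∀ i, ε i = 1 ∨ ε i = -1) ∧
  ∃ P : ZMod 3 → Bivector I F V,
    (∀ i, IsInverse (w i) (P i)) ∧
    (∀ (i : ZMod 3) (x : M) (v : V x),
      transition w P i x (transition w P i x v) = ε i • v) ∧
    ∀ (i j : ZMod 3) (X Y Z : Sec I F V),
      ε (i + 1) • L.d (w i) (transitionSec w P i X) (transitionSec w P i Y)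
          (transitionSec w P i Z) =
        ε (j + 1) • L.d (w j) (transitionSec w P j X) (transitionSec w P j Y)
          (transitionSec w P j Z)

/-- A hypersymplectic structure with torsion: `ε 1 = ε 2 = ε 3 = -1`. -/
def IsHypersymplecticWithTorsion (L : LieAlgebroid I F V) (w : ZMod 3 → TwoForm I F V) : Prop :=
  IsEpsHypersymplecticWithTorsion L (fun _ => -1) w

/-- A para-hypersymplectic structure with torsion: `ε 1 * ε 2 * ε 3 = -1`, and the `ε i` are not
all equal to `-1`. -/
def IsParaHypersymplecticWithTorsion (L : LieAlgebroid I F V)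
    (w : ZMod 3 → TwoForm I F V) : Prop :=
  ∃ ε : ZMod 3 → ℝ, ε 1 * ε 2 * ε 3 = -1 ∧ ¬ (∀ i, ε i = -1) ∧
    IsEpsHypersymplecticWithTorsion L ε w

end Bundles

end HSTorsion

end

noncomputable section

set_option linter.unusedSectionVars false

namespace HSTorsion

/-! Put `A = N (i+1)` and `B = N (i+2)`. The product `N (i+2) ∘ N (i+1) ∘ N i` telescopes to the
identity, so `N i = ± A B`; since the three signs multiply to `-1`, `A` and `B` anticommute
(`transition_relations`). Moreover `w (i+1)` is, up to sign, `w i (B ·, ·)`. Writing each covector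
as `w i ♭ X` turns `P i ♯` into the identity and `P (i+1) ♯` into `B`, so `[P i, P (i+1)]` becomes a
concomitant of `w i` and `B`. The torsion condition compares `d (w i)` on `A B`-images with the
differential of `w i (B ·, ·)` on `A`-images. Four instances of it combine to kill the concomitant
(`concomitant_eq_zero`). Any two distinct indices modulo 3 are consecutive in some order, and the
bracket is symmetric. -/

/-- The expression of the Cartan formula for the differential of the bilinear form `b`, with
respect to the derivations `D` and the bracket `br`. -/
def cartanD {Γ C : Type*} [AddCommGroup C] (br : Γ → Γ → Γ) (D : Γ → C → C)
    (b : Γ → Γ → C) (X Y Z : Γ) : C :=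
  D X (b Y Z) - D Y (b X Z) + D Z (b X Y) - b (br X Y) Z + b (br X Z) Y - b (br Y Z) X

/-- Let `A`, `B` be anticommuting operators with squares `±1`, self-adjoint for the alternating
form `b`. If `db(AB·, AB·, AB·)` and `d(b(B·, ·))(A·, A·, A·)` agree up to the sign `B²`, then
the concomitant of `b` and `B` that computes a Schouten bracket vanishes. -/
theorem concomitant_eq_zero {Γ C : Type*} [AddCommGroup Γ] [Module ℝ Γ] [AddCommGroup C]
    [Module ℝ C] (br : Γ →ₗ[ℝ] Γ →ₗ[ℝ] Γ) (br_self : ∀ X, br X X = 0)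
    (D : Γ →+ C → C) (D_neg : ∀ X f, D X (-f) = -D X f)
    (b : Γ →ₗ[ℝ] Γ →ₗ[ℝ] C) (b_self : ∀ X, b X X = 0) (A B : Γ →ₗ[ℝ] Γ) {a c : ℝ}
    (ha : a = 1 ∨ a = -1) (hc : c = 1 ∨ c = -1)
    (hAA : ∀ X, A (A X) = a • X) (hBB : ∀ X, B (B X) = c • X)
    (hBA : ∀ X, B (A X) = -A (B X))
    (hbB : ∀ X Y, b X (B Y) = b (B X) Y)
    (hd : ∀ X Y Z, c • cartanD (br · ·) (D · ·) (b · ·) (A (B X)) (A (B Y)) (A (B Z)) =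
      cartanD (br · ·) (D · ·) (fun U W => b (B U) W) (A X) (A Y) (A Z)) (X Y Z : Γ) :
    (D X (b Y (B Z)) - b Y (br X (B Z)) + (D (B X) (b Y Z) - b Y (br (B X) Z))) +
    (D Y (b Z (B X)) - b Z (br Y (B X)) + (D (B Y) (b Z X) - b Z (br (B Y) X))) +
    (D Z (b X (B Y)) - b X (br Z (B Y)) + (D (B Z) (b X Y) - b X (br (B Z) Y))) = 0 := by
  have bs : ∀ U W, b U W = -b W U := fun U W => by
    have h := b_self (U + W)
    simp only [map_add, LinearMap.add_apply, b_self, zero_add, add_zero] at h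
    exact eq_neg_of_add_eq_zero_right h
  have brs : ∀ U W, br U W = -br W U := fun U W => by
    have h := br_self (U + W)
    simp only [map_add, LinearMap.add_apply, br_self, zero_add, add_zero] at h
    exact eq_neg_of_add_eq_zero_right h
  -- With `b_B = b (B ·, ·)`, anticommutation strips off `A`: these say `db_B(X, Y, Z) = -c db(BX,
  -- BY, BZ)` and `db_B(X, BY, BZ) = -c db(BX, Y, Z)`, with the two analogues of the latter for `Y`
  -- and `Z`.
  have h1 := hd (A X) (A Y) (A Z)
  have h2 := hd (A X) (A (B Y)) (A (B Z))
  have h3 := hd (A (B X)) (A Y) (A (B Z))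
  have h4 := hd (A (B X)) (A (B Y)) (A Z)
  clear hd
  -- These fix one orientation for each form value and bracket, so that equal terms become
  -- syntactically equal.
  have b1 := bs Z X
  have b2 : b (B Z) X = -b (B X) Z := by rw [bs, hbB]
  have r1 := brs Y (B X)
  have r2 := brs (B Y) X
  have r3 := brs Z (B Y)
  have r4 := brs (B Z) Y
  have c1 : ∀ U V, b X (br U V) = -b (br U V) X := fun U V => bs _ _
  have c2 : ∀ U V, b Y (br U V) = -b (br U V) Y := fun U V => bs _ _
  have c3 : ∀ U V, b Z (br U V) = -b (br U V) Z := fun U V => bs _ _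
  rcases ha with rfl | rfl <;> rcases hc with rfl | rfl <;>
    simp only [cartanD, one_smul, neg_smul] at hAA hBB h1 h2 h3 h4 <;>
    simp only [hAA, hBB, hBA, hbB, map_neg, LinearMap.neg_apply, neg_neg, D_neg,
      Pi.neg_apply, b1, b2, r1, r2, r3, r4, c1, c2, c3] at h1 h2 h3 h4 ⊢
  -- In all four cases the combination is `(a / 2) • (h1 - c • (h2 + h3 + h4))`.
  · linear_combination (norm := module) (1 / 2 : ℝ) • (h1 - h2 - h3 - h4)
  · linear_combination (norm := module) (1 / 2 : ℝ) • (h1 + h2 + h3 + h4)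
  · linear_combination (norm := module) (1 / 2 : ℝ) • (-h1 + h2 + h3 + h4)
  · linear_combination (norm := module) (1 / 2 : ℝ) • (-h1 - h2 - h3 - h4)

/-! ### Passage from the bundle to the formal identity on sections. -/

section Sections

variable {E : Type*} [NormedAddCommGroup E] [NormedSpace ℝ E]
  {H : Type*} [TopologicalSpace H] {I : ModelWithCorners ℝ E H}
  {M : Type*} [TopologicalSpace M] [ChartedSpace H M] [IsManifold I ∞ M]
  {F : Type*} [NormedAddCommGroup F] [NormedSpace ℝ F]
  {V : M → Type*} [TopologicalSpace (TotalSpace F V)]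
  [∀ x, AddCommGroup (V x)] [∀ x, Module ℝ (V x)] [∀ x, TopologicalSpace (V x)]
  [∀ x, IsTopologicalAddGroup (V x)] [∀ x, ContinuousSMul ℝ (V x)]
  [FiberBundle F V] [VectorBundle ℝ F V]

/-- A 2-form as a bilinear map on sections. -/
def TwoForm.evalLin (w : TwoForm I F V) : Sec I F V →ₗ[ℝ] Sec I F V →ₗ[ℝ] M → ℝ :=
  LinearMap.mk₂ ℝ w.eval
    (fun X Y Z => funext fun x => by simp [TwoForm.eval])
    (fun r X Y => funext fun x => by simp [TwoForm.eval])
    (fun X Y Z => funext fun x => by simp [TwoForm.eval])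
    (fun r X Y => funext fun x => by simp [TwoForm.eval])

/-- The transition morphism `N i` as a linear map on sections. -/
def transitionLin (w : ZMod 3 → TwoForm I F V) (P : ZMod 3 → Bivector I F V) (i : ZMod 3) :
    Sec I F V →ₗ[ℝ] Sec I F V where
  toFun := transitionSec w P i
  map_add' X Y := ContMDiffSection.ext fun x => by simp [transitionSec_apply]
  map_smul' r X := ContMDiffSection.ext fun x => by simp [transitionSec_apply]

/-- The action of sections on functions through the anchor, additive in the section. -/
def LieAlgebroid.derivHom (L : LieAlgebroid I F V) : Sec I F V →+ (M → ℝ) → M → ℝ where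
  toFun := L.deriv
  map_zero' := by
    ext f x
    exact (congrArg _ (map_zero (L.anchor x))).trans (map_zero (mfderiv I 𝓘(ℝ, ℝ) f x))
  map_add' X Y := by
    ext f x
    exact (congrArg _ (map_add (L.anchor x) _ _)).trans (map_add (mfderiv I 𝓘(ℝ, ℝ) f x) _ _)

/-- Oddness holds for every function, differentiable or not. As all scalars involved are signs, it
is the only property in `f` that the formal identity asks of the derivations. -/
theorem LieAlgebroid.deriv_neg (L : LieAlgebroid I F V) (X : Sec I F V) (f : M → ℝ) :
    L.deriv X (-f) = -L.deriv X f := by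
  ext x
  simp only [LieAlgebroid.deriv, dirDeriv, mfderiv_neg, Pi.neg_apply]
  rfl

/-- Rescaling a form and its arguments by signs rescales its differential. -/
theorem cartanD_sign {Γ C : Type*} [AddCommGroup Γ] [Module ℝ Γ] [AddCommGroup C] [Module ℝ C]
    (br : Γ →ₗ[ℝ] Γ →ₗ[ℝ] Γ) (D : Γ →+ C → C) (D_neg : ∀ X f, D X (-f) = -D X f)
    (b : Γ →ₗ[ℝ] Γ →ₗ[ℝ] C) {r s : ℝ} (hr : r = 1 ∨ r = -1) (hs : s = 1 ∨ s = -1)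
    (X Y Z : Γ) :
    cartanD (br · ·) (D · ·) (fun U W => r • b U W) (s • X) (s • Y) (s • Z) =
      (r * s) • cartanD (br · ·) (D · ·) (b · ·) X Y Z := by
  rcases hr with rfl | rfl <;> rcases hs with rfl | rfl <;>
    simp only [cartanD, one_smul, neg_smul, map_neg, LinearMap.neg_apply, neg_neg, D_neg,
      Pi.neg_apply, mul_one, mul_neg] <;> abel

theorem IsInverse.unique {w : TwoForm I F V} {P Q : Bivector I F V} (hP : IsInverse w P)
    (hQ : IsInverse w Q) : P = Q := by
  have h : P.sharp = Q.sharp := ContMDiffSection.ext fun x => ContinuousLinearMap.ext fun a => by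
    rw [← hP.1 x (Q.sharp x a), hQ.2]
  cases P
  cases Q
  congr

theorem IsInverse.flatSec_sharpSec {w : TwoForm I F V} {P : Bivector I F V}
    (h : IsInverse w P) (α : DualSec I F V) : w.flatSec (P.sharpSec α) = α :=
  ContMDiffSection.ext fun x => h.2 x (α x)

theorem IsInverse.sharpSec_flatSec {w : TwoForm I F V} {P : Bivector I F V}
    (h : IsInverse w P) (X : Sec I F V) : P.sharpSec (w.flatSec X) = X :=
  ContMDiffSection.ext fun x => h.1 x (X x)

theorem TwoForm.swap (w : TwoForm I F V) (x : M) (u v : V x) :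
    w.flat x u v = -w.flat x v u := by
  have h := w.alt x (u + v)
  simp only [map_add, add_apply, w.alt, zero_add, add_zero] at h
  exact eq_neg_of_add_eq_zero_right h

theorem LieAlgebroid.schouten_comm (L : LieAlgebroid I F V) (P Q : Bivector I F V)
    (α β γ : DualSec I F V) : L.schouten P Q α β γ = L.schouten Q P α β γ := by
  simp only [LieAlgebroid.schouten, LieAlgebroid.schoutenTerm, add_comm]

/-- The pointwise algebra of the transition morphisms when `ε 1 * ε 2 * ε 3 = -1`. -/
theorem transition_relations (w : ZMod 3 → TwoForm I F V) (P : ZMod 3 → Bivector I F V)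
    (hP : ∀ k, IsInverse (w k) (P k)) (ε : ZMod 3 → ℝ) (hε : ∀ i, ε i = 1 ∨ ε i = -1)
    (hN : ∀ (i : ZMod 3) (x : M) (v : V x),
      transition w P i x (transition w P i x v) = ε i • v)
    (i : ZMod 3) (hprod : ε i * ε (i + 1) * ε (i + 2) = -1) (x : M) (v : V x) :
    transition w P i x v =
        (ε (i + 1) * ε (i + 2)) • transition w P (i + 1) x (transition w P (i + 2) x v) ∧
      transition w P (i + 2) x (transition w P (i + 1) x v) =
        -transition w P (i + 1) x (transition w P (i + 2) x v) := by
  have e1 : i + 1 - 1 = i := by ring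
  have e2 : i + 1 + 1 = i + 2 := by ring
  have e3 : i + 2 - 1 = i + 1 := by ring
  have e4 : i + 2 + 1 = i := by clear hprod; revert i; decide
  have e5 : i - 1 = i + 2 := by clear hprod; revert i; decide
  -- Adjacent factors `w k ♭` and `P k ♯` cancel around the cycle of indices.
  have hone : ∀ v, transition w P (i + 2) x (transition w P (i + 1) x (transition w P i x v)) = v :=
    fun v => by
      simp only [transition, ContinuousLinearMap.comp_apply, e1, e2, e3, e4, e5, (hP _).2,
        (hP _).1]
  have sq : ∀ k, ε k * ε k = 1 := fun k => by rcases hε k with h | h <;> simp [h]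
  have h0 := hN i x
  have hA := hN (i + 1) x
  have hB := hN (i + 2) x
  revert h0 hA hB hone
  generalize transition w P i x = N
  generalize transition w P (i + 1) x = A
  generalize transition w P (i + 2) x = B
  intro hone h0 hA hB
  -- Since `A` and `B` are their own inverses up to sign, `B A N = id` gives `N = ± A B`.
  have key : ∀ v, N v = (ε (i + 1) * ε (i + 2)) • A (B v) := fun v => by
    have h : A (B (B (A (N v)))) = A (B v) := by rw [hone]
    rw [hB, map_smul, hA, smul_smul] at h
    rw [← h, smul_smul]
    have : ε (i + 1) * ε (i + 2) * (ε (i + 2) * ε (i + 1)) = 1 := by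
      linear_combination ε (i + 1) * ε (i + 1) * sq (i + 2) + sq (i + 1)
    rw [this, one_smul]
  refine ⟨key v, ?_⟩
  -- Likewise `B A` is the inverse of `N`, hence `ε i • N`; by `key` this is the triple product of
  -- signs times `A B`.
  have h := hone (N v)
  rw [h0, map_smul, map_smul, key] at h
  rw [← one_smul ℝ (B (A v)), ← sq i, ← smul_smul, h, smul_smul, ← mul_assoc, hprod, neg_one_smul]

/-- Consecutive inverses in a structure with torsion commute for the Schouten bracket. -/
theorem schouten_consecutive_eq_zero (L : LieAlgebroid I F V) (w : ZMod 3 → TwoForm I F V)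
    (P : ZMod 3 → Bivector I F V) (hP : ∀ k, IsInverse (w k) (P k)) (ε : ZMod 3 → ℝ)
    (hw : IsEpsHypersymplecticWithTorsion L ε w) (i : ZMod 3)
    (hprod : ε i * ε (i + 1) * ε (i + 2) = -1) (α β γ : DualSec I F V) :
    L.schouten (P i) (P (i + 1)) α β γ = 0 := by
  obtain ⟨hε, P', hP', hN, hd⟩ := hw
  -- The inverses supplied by the structure are the given ones, by uniqueness.
  obtain rfl : P' = P := funext fun k => (hP' k).unique (hP k)
  have hrel := transition_relations w P' hP ε hε hN i hprod
  have e2 : i + 1 + 1 = i + 2 := by ring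
  have e3 : i + 2 - 1 = i + 1 := by ring
  have e4 : i + 2 + 1 = i := by clear hprod hrel; revert i; decide
  have sq : ∀ k, ε k * ε k = 1 := fun k => by rcases hε k with h | h <;> simp [h]
  have hwB : ∀ x (u v : V x), (w (i + 1)).flat x u v =
      ε (i + 2) * (w i).flat x (transition w P' (i + 2) x u) v := fun x u v => by
    have h : (w (i + 1)).flat x (transition w P' (i + 2) x (transition w P' (i + 2) x u)) =
        (w i).flat x (transition w P' (i + 2) x u) := by
      simp only [transition, ContinuousLinearMap.comp_apply, e3, e4, (hP _).2]
    rw [← h, hN, map_smul, smul_apply, smul_eq_mul, ← mul_assoc, sq, one_mul]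
  set A := transitionLin w P' (i + 1)
  set B := transitionLin w P' (i + 2) with hB
  have hAB : ∀ X, transitionSec w P' i X = (ε (i + 1) * ε (i + 2)) • A (B X) := fun X =>
    ContMDiffSection.ext fun x => (hrel x (X x)).1
  have hs : ε (i + 1) * ε (i + 2) = 1 ∨ ε (i + 1) * ε (i + 2) = -1 := by
    rcases hε (i + 1) with h | h <;> rcases hε (i + 2) with h' | h' <;> simp [h, h']
  have hBX : ∀ X, (P' (i + 1)).sharpSec ((w i).flatSec X) = B X := fun X =>
    ContMDiffSection.ext fun x => by
      simp only [hB, transitionLin, LinearMap.coe_mk, AddHom.coe_mk, transitionSec, e3, e4]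
  have main := concomitant_eq_zero L.bracket L.bracket_self L.derivHom L.deriv_neg (w i).evalLin
    (fun X => funext fun x => (w i).alt x (X x)) A B (hε (i + 1)) (hε (i + 2))
    (fun X => ContMDiffSection.ext fun x => hN (i + 1) x (X x))
    (fun X => ContMDiffSection.ext fun x => hN (i + 2) x (X x))
    (fun X => ContMDiffSection.ext fun x => (hrel x (X x)).2)
    (fun X Y => funext fun x => by
      -- Self-adjointness of `B` for `w i` is the skew-symmetry of `w (i+1)`.
      have h1 := hwB x (X x) (Y x)
      have h2 := hwB x (Y x) (X x)
      rw [(w (i + 1)).swap, h2, ← mul_neg, ← (w i).swap] at h1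
      exact mul_left_cancel₀ (left_ne_zero_of_mul_eq_one (sq (i + 2))) h1)
    (fun X Y Z => by
      have hl := cartanD_sign L.bracket L.derivHom L.deriv_neg (w i).evalLin (Or.inl rfl) hs
        (A (B X)) (A (B Y)) (A (B Z))
      have hr := cartanD_sign L.bracket L.derivHom L.deriv_neg ((w i).evalLin.comp B) (hε (i + 2))
        (Or.inl rfl) (A X) (A Y) (A Z)
      simp only [one_smul, one_mul, mul_one] at hl hr
      have he : (w (i + 1)).eval = fun U W => ε (i + 2) • (w i).evalLin (B U) W :=
        funext fun U => funext fun W => funext fun x => hwB x (U x) (W x)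
      -- The torsion condition with `N i` replaced by `± A B`. Extracting the signs leaves the
      -- factor `ε (i+2)` on the left and `1` on the right.
      have hd' : ε (i + 1) • cartanD (L.bracket · ·) (L.derivHom · ·) (fun U W => (w i).evalLin U W)
          ((ε (i + 1) * ε (i + 2)) • A (B X)) ((ε (i + 1) * ε (i + 2)) • A (B Y))
          ((ε (i + 1) * ε (i + 2)) • A (B Z)) =
          ε (i + 2) • cartanD (L.bracket · ·) (L.derivHom · ·) (w (i + 1)).eval
            (A X) (A Y) (A Z) := by
        have h := hd i (i + 1) X Y Z
        rw [hAB, hAB, hAB, e2] at h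
        exact h
      rw [hl, he] at hd'
      have h := hd'.trans (congrArg _ hr)
      rw [smul_smul, smul_smul, sq, one_smul, ← mul_assoc, sq, one_mul] at h
      exact h)
    ((P' i).sharpSec α) ((P' i).sharpSec β) ((P' i).sharpSec γ)
  rw [← (hP i).flatSec_sharpSec α, ← (hP i).flatSec_sharpSec β, ← (hP i).flatSec_sharpSec γ]
  simp only [LieAlgebroid.schouten, LieAlgebroid.schoutenTerm, hBX, (hP i).sharpSec_flatSec]
  exact main

end Sections

end HSTorsion

end

theorem mainTheorem8
    {E : Type*} [NormedAddCommGroup E] [NormedSpace ℝ E] [FiniteDimensional ℝ E]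
    {H : Type*} [TopologicalSpace H] {I : ModelWithCorners ℝ E H}
    {M : Type*} [TopologicalSpace M] [ChartedSpace H M] [IsManifold I ∞ M]
    [BoundarylessManifold I M] [T2Space M] [SecondCountableTopology M]
    {F : Type*} [NormedAddCommGroup F] [NormedSpace ℝ F] [FiniteDimensional ℝ F]
    {V : M → Type*} [TopologicalSpace (TotalSpace F V)]
    [∀ x, AddCommGroup (V x)] [∀ x, Module ℝ (V x)] [∀ x, TopologicalSpace (V x)]
    [∀ x, IsTopologicalAddGroup (V x)] [∀ x, ContinuousSMul ℝ (V x)]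
    [FiberBundle F V] [VectorBundle ℝ F V] [ContMDiffVectorBundle ∞ F V I]
    (L : HSTorsion.LieAlgebroid I F V)
    (w : ZMod 3 → HSTorsion.TwoForm I F V)
    (hw : HSTorsion.IsHypersymplecticWithTorsion L w ∨
      HSTorsion.IsParaHypersymplecticWithTorsion L w)
    (P : ZMod 3 → HSTorsion.Bivector I F V)
    (hP : ∀ k, HSTorsion.IsInverse (w k) (P k)) :
    ∀ i j : ZMod 3, i ≠ j →
      ∀ (α β γ : HSTorsion.DualSec I F V) (x : M), L.schouten (P i) (P j) α β γ x = 0 := by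
  -- Both kinds of structure enter only through the product of signs being `-1`.
  obtain ⟨ε, hprod, hε⟩ : ∃ ε : ZMod 3 → ℝ, ε 1 * ε 2 * ε 3 = -1 ∧
      HSTorsion.IsEpsHypersymplecticWithTorsion L ε w := by
    rcases hw with h | ⟨ε, hprod, -, h⟩
    · exact ⟨fun _ => -1, by norm_num, h⟩
    · exact ⟨ε, hprod, h⟩
  have hp : ∀ i : ZMod 3, ε i * ε (i + 1) * ε (i + 2) = -1 := by
    have h3 : (3 : ZMod 3) = 0 := rfl
    have h12 : (1 : ZMod 3) + 1 = 2 := rfl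
    have h13 : (1 : ZMod 3) + 2 = 0 := rfl
    have h21 : (2 : ZMod 3) + 1 = 0 := rfl
    have h22 : (2 : ZMod 3) + 2 = 1 := rfl
    rw [h3] at hprod
    have hi : ∀ i : ZMod 3, i = 0 ∨ i = 1 ∨ i = 2 := by decide
    intro i
    rcases hi i with rfl | rfl | rfl
    · rw [zero_add, zero_add, ← hprod]; ring
    · rw [h12, h13, hprod]
    · rw [h21, h22, ← hprod]; ring
  have key := fun i => HSTorsion.schouten_consecutive_eq_zero L w P hP ε hε i (hp i)
  intro i j hij α β γ x
  have hj : ∀ i j : ZMod 3, i ≠ j → j = i + 1 ∨ i = j + 1 := by decide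
  rcases hj i j hij with rfl | rfl
  · rw [key]; rfl
  · rw [L.schouten_comm, key]; rfl
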